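/- Let $0<q<p<1$ be fixed. For even $n$, let $G(n,p,q)$ be the random graph on $n$ labelled vertices in which the first $n/2$ vertices form one group and the remaining $n/2$ the other, and every pair of different vertices is joined by an edge, independently, with probability $p$ if both are in the same group and with probability $q$ otherwise. Let $A$ be its adjacency matrix, $\lambda_2$ the second largest eigenvalue of $A$ (counted with multiplicity), and let $\mathbf g\in\{1,-1\}^n$ be the group vector, equal to $1$ on the first group and to $-1$ on the second. By a second eigenvector we mean a vector $\mathbf v_2\in\mathbb R^n$ with $A\mathbf v_2=\lambda_2\mathbf v_2$ that is normalised in one of two ways: either $\|\mathbf v_2\|=1$ and $\langle \mathbf g,\mathbf v_2\rangle\ge 0$, or $\langle\mathbf g,\mathbf v_2\rangle=\sqrt n$. Write $\mathbf v_2=\mathbf g/\sqrt n+\mathbf e_2$ (the second normalisation says that $\mathbf e_2\perp\mathbf g$). All norms of vectors are Euclidean. **Theorem (Hidden Information).** For every $\varepsilon_0>0$ there are constants $K,c>0$ and $N\in\mathbb N$, depending only on $p,q,\varepsilon_0$, such that for every even $n\ge N$, with probability at least $$1-\exp\left(-c\,n^{\min(1,\,2\varepsilon_0)}\right),$$ every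 second eigenvector $\mathbf v_2$, in either normalisation, satisfies $$\mathbf e_2=\frac{2}{(p-q)\,n^{3/2}}\left(A\mathbf g-\lambda_2\mathbf g\right)+\mathbf{error},\qquad \|\mathbf{error}\|\le K\,n^{-1+\varepsilon_0}.$$ -/

import Mathlib

open MeasureTheory ProbabilityTheory
open scoped unitInterval

namespace SBM

/-- The group membership vector `g ∈ {1, -1}ⁿ`: the first `n / 2` vertices form one group, the
remaining vertices the other. -/
noncomputable def groupVec (n : ℕ) : EuclideanSpace ℝ (Fin n) :=
  WithLp.toLp 2 fun i => if (i : ℕ) < n / 2 then 1 else -1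

/-- The probability that a given pair of different vertices is connected: `p` for two vertices in
the same group, `q` for two vertices in different groups. -/
noncomputable def edgeProb (n : ℕ) (p q : I) : Sym2 (Fin n) → I :=
  Sym2.lift ⟨fun i j => if ((i : ℕ) < n / 2 ↔ (j : ℕ) < n / 2) then p else q, fun i j => by
    simp only [iff_comm]⟩

/-- The set of unordered pairs `{e | ω e}`, regarded as the edge set of a graph
(degenerate pairs are discarded). -/
def graphOf (n : ℕ) (ω : Sym2 (Fin n) → Prop) : SimpleGraph (Fin n) :=
  SimpleGraph.fromEdgeSet {e | ω e}

theorem measurable_graphOf (n : ℕ) : Measurable (graphOf n) := by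
  unfold graphOf
  rw [SimpleGraph.measurable_iff_adj]
  intro u v
  simp only [SimpleGraph.fromEdgeSet_adj, Set.mem_ofPred_eq]
  exact (measurable_pi_apply (s(u, v))).and measurable_const

/-- The law of the stochastic block model `G(n, p, q)` on labelled graphs with `n` vertices:
independently over all pairs of different vertices, the pair is an edge with probability
`edgeProb n p q`. -/
noncomputable def law (n : ℕ) (p q : I) : Measure (SimpleGraph (Fin n)) :=
  (Measure.pi fun e : Sym2 (Fin n) => bernoulliMeasure True False (edgeProb n p q e)).map
    (graphOf n)

instance isProbabilityMeasure_law (n : ℕ) (p q : I) : IsProbabilityMeasure (law n p q) :=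
  Measure.isProbabilityMeasure_map (measurable_graphOf n).aemeasurable

/-- The adjacency matrix as a linear operator on Euclidean space. -/
noncomputable def adjOp {n : ℕ} (G : SimpleGraph (Fin n)) :
    EuclideanSpace ℝ (Fin n) →ₗ[ℝ] EuclideanSpace ℝ (Fin n) :=
  open scoped Classical in Matrix.toEuclideanLin (G.adjMatrix ℝ)

/-- The second largest eigenvalue `λ₂` (counted with multiplicity) of the adjacency matrix:
`eigenvalues₀` lists the eigenvalues in decreasing order.
It is only meaningful for `n ≥ 2`; otherwise it is set to `0`. -/
noncomputable def lambda2 {n : ℕ} (G : SimpleGraph (Fin n)) : ℝ :=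
  open scoped Classical in
  if h : 1 < Fintype.card (Fin n) then
    (SimpleGraph.isHermitian_adjMatrix (G := G) (R := ℝ)).eigenvalues₀ ⟨1, h⟩
  else 0

/-- `v` is a second eigenvector of the adjacency matrix, with its sign and its length fixed in one
of the two customary ways: either `v` is a unit vector with `⟨g, v⟩ ≥ 0`, or `⟨g, v⟩ = √n`, which
says that `v - g / √n` is orthogonal to `g`. -/
def IsSecondEigenvector {n : ℕ} (G : SimpleGraph (Fin n)) (v : EuclideanSpace ℝ (Fin n)) : Prop :=
  adjOp G v = lambda2 G • v ∧
    ((‖v‖ = 1 ∧ 0 ≤ inner ℝ (groupVec n) v) ∨ inner ℝ (groupVec n) v = √(n : ℝ))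

/-- The deviation `e₂` of the second eigenvector `v` from the normalised membership vector:
`v = g / √n + e₂`. -/
noncomputable def e2 {n : ℕ} (v : EuclideanSpace ℝ (Fin n)) : EuclideanSpace ℝ (Fin n) :=
  v - (√(n : ℝ))⁻¹ • groupVec n

/-- The first order term `2 / ((p - q) n ^ (3 / 2)) * (A g - λ₂ g)`. -/
noncomputable def mainTerm {n : ℕ} (p q : ℝ) (G : SimpleGraph (Fin n)) :
    EuclideanSpace ℝ (Fin n) :=
  (2 / ((p - q) * (n : ℝ) ^ (3 / 2 : ℝ))) • (adjOp G (groupVec n) - lambda2 G • groupVec n)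

end SBM

namespace SBM

/-! With `u`, `g` the normalised constant and group vectors, `A = a u uᵀ + b g gᵀ + R`, where `a =
(p+q)n/2`, `b = (p-q)n/2` and `R` is the centred noise minus `p` times the identity. Off an event of
probability `2 exp(-n)` the noise has norm `O(√n)` (`exists_law_norm_noiseOp_gt_le`: Hoeffding and a
net), so Weyl's inequality puts `λ₂` within `O(√n)` of `b`.

For `e = v - g` the eigenvalue equation gives `b e - (A g - λ₂ g) = (b - λ₂) e + R e + a⟪u, e⟫ u +
b⟪g, e⟫ g`. Since `‖e‖ = O(n^(-1/2))` and `⟪g, e⟫ = O(1/n)`, every term but the one along `u` is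
`O(1)`, hence `O(1/n)` after division by `b`. Along `u` the size of `e` alone is not enough.
Projecting the equation on `u` reduces `⟪u, e⟫` to `⟪u, R g⟫`, a single linear form in the
independent edges, which exceeds `n^ε₀` with probability at most `2 exp(-n^(2ε₀))`. The two
exceptional events produce the minimum in the exponent. The deterministic half is
`norm_sub_first_order_le`. -/

/-! ### Hoeffding bounds for independent edge indicators. -/

instance measurableSingletonClass_simpleGraph (n : ℕ) :
    MeasurableSingletonClass (SimpleGraph (Fin n)) := by
  refine ⟨fun G => ?_⟩
  have h : ({G} : Set (SimpleGraph (Fin n))) =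
      SimpleGraph.Adj ⁻¹' ({G.Adj} : Set (Fin n → Fin n → Prop)) := by
    ext H
    exact ⟨fun h => congrArg _ h, fun h => SimpleGraph.ext h⟩
  rw [h]
  exact SimpleGraph.measurable_adj (measurableSet_singleton _)

/-- The product measure on the indicators of all unordered pairs. -/
noncomputable def pairMeasure (n : ℕ) (p q : I) : Measure (Sym2 (Fin n) → Prop) :=
  Measure.pi fun e : Sym2 (Fin n) => bernoulliMeasure True False (edgeProb n p q e)

instance isProbabilityMeasure_pairMeasure (n : ℕ) (p q : I) :
    IsProbabilityMeasure (pairMeasure n p q) := by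
  unfold pairMeasure; infer_instance

theorem law_real_apply (n : ℕ) (p q : I) (S : Set (SimpleGraph (Fin n))) :
    (law n p q).real S = (pairMeasure n p q).real (graphOf n ⁻¹' S) := by
  have : MeasurableSet S := (Set.toFinite S).measurableSet
  rw [law, map_measureReal_apply (measurable_graphOf n) this, pairMeasure]

open scoped Classical in
/-- The centred indicator of a pair. -/
noncomputable def centred (n : ℕ) (p q : I) (e : Sym2 (Fin n)) (a : Prop) : ℝ :=
  (if a then 1 else 0) - (edgeProb n p q e : ℝ)

theorem measurable_centred (n : ℕ) (p q : I) (e : Sym2 (Fin n)) :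
    Measurable (centred n p q e) := measurable_of_finite _

/-- Hoeffding's lemma: the variable is centred and lives in an interval of length 1. -/
theorem hasSubgaussianMGF_centred (n : ℕ) (p q : I) (e : Sym2 (Fin n)) :
    HasSubgaussianMGF (fun ω : Sym2 (Fin n) → Prop => centred n p q e (ω e)) (1 / 4)
      (pairMeasure n p q) := by
  set P := edgeProb n p q e with hP
  have h1 : HasSubgaussianMGF (centred n p q e) ((‖(1 - P : ℝ) - (-P)‖₊ / 2) ^ 2)
      (bernoulliMeasure True False P) := by
    refine hasSubgaussianMGF_of_mem_Icc_of_integral_eq_zero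
      (measurable_centred n p q e).aemeasurable (.of_forall fun a => ?_) ?_
    · have := P.2
      by_cases ha : a <;> simp [centred, ha, ← hP]
    · rw [integral_bernoulliMeasure]
      simp [centred, ← hP]
      ring
  have h2 : (‖(1 - P : ℝ) - (-P)‖₊ / 2) ^ 2 = 1 / 4 := by
    ext; simp; norm_num
  rw [h2] at h1
  refine HasSubgaussianMGF.of_map (Y := fun ω : Sym2 (Fin n) → Prop => ω e)
    (X := centred n p q e) (measurable_pi_apply e).aemeasurable ?_
  rwa [pairMeasure, (measurePreserving_eval _ e).map_eq]

theorem iIndepFun_centred (n : ℕ) (p q : I) :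
    iIndepFun (fun e (ω : Sym2 (Fin n) → Prop) => centred n p q e (ω e)) (pairMeasure n p q) :=
  iIndepFun_pi fun e => (measurable_centred n p q e).aemeasurable

theorem hasSubgaussianMGF_mono {Ω : Type*} [MeasurableSpace Ω] {μ : Measure Ω} {X : Ω → ℝ}
    {c c' : NNReal} (h : HasSubgaussianMGF X c μ) (hc : c ≤ c') : HasSubgaussianMGF X c' μ where
  integrable_exp_mul := h.integrable_exp_mul
  mgf_le t := (h.mgf_le t).trans (by gcongr)

/-- Hoeffding's inequality for a linear combination of the centred indicators. -/
theorem measure_abs_sum_centred_ge_le (n : ℕ) (p q : I) (c : Sym2 (Fin n) → ℝ)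
    (hc : ∑ e, c e ^ 2 ≤ 2) {t : ℝ} (ht : 0 ≤ t) :
    (pairMeasure n p q).real {ω | t ≤ |∑ e, c e * centred n p q e (ω e)|} ≤
      2 * Real.exp (-t ^ 2) := by
  -- The variance proxy is `(1/4) ∑ c e ^ 2 ≤ 1/2`, which makes the tail exponent exactly `t ^ 2`.
  have h1 : HasSubgaussianMGF (fun ω : Sym2 (Fin n) → Prop => ∑ e, c e * centred n p q e (ω e))
      (1 / 2) (pairMeasure n p q) := by
    have h2 : iIndepFun (fun e (ω : Sym2 (Fin n) → Prop) => c e * centred n p q e (ω e))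
        (pairMeasure n p q) :=
      (iIndepFun_centred n p q).comp (fun e x => c e * x) fun e => measurable_const_mul _
    refine hasSubgaussianMGF_mono (HasSubgaussianMGF.sum_of_iIndepFun h2 (s := Finset.univ)
      fun e _ => (hasSubgaussianMGF_centred n p q e).const_mul (c e)) ?_
    rw [← NNReal.coe_le_coe]
    rw [NNReal.coe_sum]
    change ∑ e, c e ^ 2 * ((1 / 4 : NNReal) : ℝ) ≤ _
    rw [← Finset.sum_mul]
    push_cast
    linarith
  have h2 : ∀ {Y : (Sym2 (Fin n) → Prop) → ℝ}, HasSubgaussianMGF Y (1 / 2) (pairMeasure n p q) →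
      (pairMeasure n p q).real {ω | t ≤ Y ω} ≤ Real.exp (-t ^ 2) := fun h =>
    (h.measure_ge_le ht).trans (by norm_num)
  have h3 : {ω : Sym2 (Fin n) → Prop | t ≤ |∑ e, c e * centred n p q e (ω e)|} ⊆
      {ω | t ≤ ∑ e, c e * centred n p q e (ω e)} ∪
        {ω | t ≤ -∑ e, c e * centred n p q e (ω e)} := fun ω hω => by
    simpa only [Set.mem_union, Set.mem_ofPred_eq, le_abs] using hω
  refine (measureReal_mono h3 (measure_ne_top _ _)).trans ?_
  refine (measureReal_union_le _ _).trans ?_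
  exact (add_le_add (h2 h1) (h2 h1.neg)).trans_eq (two_mul _).symm

/-! ### The noise and its bilinear form. -/

open scoped Classical in
/-- The deviation of the adjacency matrix from its expectation. -/
noncomputable def noise {n : ℕ} (p q : I) (G : SimpleGraph (Fin n)) : Matrix (Fin n) (Fin n) ℝ :=
  Matrix.of fun i j => if i = j then 0 else G.adjMatrix ℝ i j - (edgeProb n p q s(i, j) : ℝ)

/-- The deviation of the adjacency operator from its expectation. -/
noncomputable def noiseOp {n : ℕ} (p q : I) (G : SimpleGraph (Fin n)) :
    EuclideanSpace ℝ (Fin n) →L[ℝ] EuclideanSpace ℝ (Fin n) :=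
  (Matrix.toEuclideanLin (noise p q G)).toContinuousLinearMap

theorem inner_toEuclideanLin {n : ℕ} (B : Matrix (Fin n) (Fin n) ℝ)
    (x y : EuclideanSpace ℝ (Fin n)) :
    inner ℝ x (Matrix.toEuclideanLin B y) = ∑ i, ∑ j, x i * B i j * y j := by
  simp only [PiLp.inner_apply, Matrix.toLpLin_apply, Matrix.mulVec, dotProduct]
  refine Finset.sum_congr rfl fun i _ => ?_
  simp [Finset.sum_mul]
  exact Finset.sum_congr rfl fun j _ => by ring

theorem card_filter_mk_eq_le {n : ℕ} (e : Sym2 (Fin n)) :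
    (Finset.univ.filter fun ij : Fin n × Fin n => s(ij.1, ij.2) = e).card ≤ 2 := by
  induction e with
  | h a b =>
    refine (Finset.card_le_card (t := {(a, b), (b, a)}) fun ij h => ?_).trans
      Finset.card_le_two
    simpa [Prod.ext_iff] using h

/-- The coefficient of the indicator of a pair in the bilinear form of the noise. -/
noncomputable def pairCoeff {n : ℕ} (x y : EuclideanSpace ℝ (Fin n)) (e : Sym2 (Fin n)) : ℝ :=
  ∑ ij : Fin n × Fin n with s(ij.1, ij.2) = e, if ij.1 = ij.2 then 0 else x ij.1 * y ij.2

/-- Cauchy–Schwarz on the at most two orderings of each pair; the fibres then add up to the full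
double sum. -/
theorem sum_pairCoeff_sq_le {n : ℕ} (x y : EuclideanSpace ℝ (Fin n)) :
    ∑ e, pairCoeff x y e ^ 2 ≤ 2 * (‖x‖ ^ 2 * ‖y‖ ^ 2) := by
  have h1 : ∀ e, pairCoeff x y e ^ 2 ≤
      ∑ ij : Fin n × Fin n with s(ij.1, ij.2) = e, 2 * (x ij.1 ^ 2 * y ij.2 ^ 2) := fun e => by
    refine sq_sum_le_card_mul_sum_sq.trans ?_
    rw [← Finset.mul_sum]
    refine mul_le_mul (by exact_mod_cast card_filter_mk_eq_le e) (Finset.sum_le_sum fun ij _ => ?_)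
      (Finset.sum_nonneg fun _ _ => sq_nonneg _) zero_le_two
    split_ifs
    · rw [zero_pow two_ne_zero]; positivity
    · rw [mul_pow]
  refine (Finset.sum_le_sum fun e _ => h1 e).trans_eq ?_
  rw [Finset.sum_fiberwise, ← Finset.mul_sum, EuclideanSpace.norm_sq_eq, EuclideanSpace.norm_sq_eq,
    Finset.sum_mul_sum, Fintype.sum_prod_type]
  simp

/-- The entries `(i, j)` and `(j, i)` coincide; grouping them leaves a linear form in independent
variables. -/
theorem inner_noiseOp_graphOf {n : ℕ} (p q : I) (ω : Sym2 (Fin n) → Prop)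
    (x y : EuclideanSpace ℝ (Fin n)) :
    inner ℝ x (noiseOp p q (graphOf n ω) y) =
      ∑ e, pairCoeff x y e * centred n p q e (ω e) := by
  have h1 : ∀ e, pairCoeff x y e * centred n p q e (ω e) =
      ∑ ij : Fin n × Fin n with s(ij.1, ij.2) = e,
        x ij.1 * noise p q (graphOf n ω) ij.1 ij.2 * y ij.2 := fun e => by
    rw [pairCoeff, Finset.sum_mul]
    refine Finset.sum_congr rfl fun ij hij => ?_
    obtain rfl := (Finset.mem_filter.1 hij).2
    by_cases h : ij.1 = ij.2
    · simp [noise, h]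
    · have h2 : (graphOf n ω).Adj ij.1 ij.2 ↔ ω s(ij.1, ij.2) := by simp [graphOf, h]
      by_cases h3 : ω s(ij.1, ij.2) <;>
        simp only [noise, Matrix.of_apply, h, if_false, centred, SimpleGraph.adjMatrix_apply, h2,
          h3, if_true] <;> ring
  rw [Finset.sum_congr rfl fun e _ => h1 e, Finset.sum_fiberwise, Fintype.sum_prod_type]
  exact inner_toEuclideanLin _ x y

/-- Concentration of the bilinear form of the noise at a fixed pair of vectors. -/
theorem law_abs_inner_noiseOp_ge_le {n : ℕ} (p q : I) {x y : EuclideanSpace ℝ (Fin n)}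
    (hx : ‖x‖ ≤ 1) (hy : ‖y‖ ≤ 1) {t : ℝ} (ht : 0 ≤ t) :
    (law n p q).real {G | t ≤ |inner ℝ x (noiseOp p q G y)|} ≤ 2 * Real.exp (-t ^ 2) := by
  rw [law_real_apply]
  simp only [Set.preimage_ofPred_eq, inner_noiseOp_graphOf]
  refine measure_abs_sum_centred_ge_le n p q _ ((sum_pairCoeff_sq_le x y).trans ?_) ht
  have : ‖x‖ ^ 2 * ‖y‖ ^ 2 ≤ 1 := mul_le_one₀ (pow_le_one₀ (norm_nonneg _) hx) (by positivity)
    (pow_le_one₀ (norm_nonneg _) hy)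
  linarith

/-! ### Operator norm of the noise through a lattice net. -/

/-- The integer points of the ball of radius `4 √n`. -/
noncomputable def intNet (n : ℕ) : Finset (Fin n → ℤ) :=
  (Fintype.piFinset fun _ => Finset.Icc (-(4 * n : ℤ)) (4 * n)).filter
    fun z => ∑ i, z i ^ 2 ≤ 16 * n

/-- An integer point, scaled into the unit ball. -/
noncomputable def netVec {n : ℕ} (z : Fin n → ℤ) : EuclideanSpace ℝ (Fin n) :=
  WithLp.toLp 2 fun i => (z i : ℝ) / (4 * √n)

theorem norm_netVec_le {n : ℕ} {z : Fin n → ℤ} (hz : ∑ i, z i ^ 2 ≤ 16 * (n : ℤ)) :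
    ‖netVec z‖ ≤ 1 := by
  rw [← sq_le_one_iff₀ (norm_nonneg _), EuclideanSpace.norm_sq_eq]
  simp only [netVec, Real.norm_eq_abs, sq_abs, div_pow, mul_pow, Real.sq_sqrt (Nat.cast_nonneg n)]
  rw [← Finset.sum_div]
  refine div_le_one_of_le₀ ?_ (by positivity)
  norm_num
  exact_mod_cast hz

/-- Give `z` the weight `∏ 2^(-|z i|)`. On the net `∑ |z i| ≤ ∑ (z i)² ≤ 16 n`, so each point weighs
at least `2^(-16n)`, while all of `ℤⁿ` weighs `C ^ n`. -/
theorem exists_card_intNet_le : ∃ L : ℝ, 0 ≤ L ∧ ∀ n, ((intNet n).card : ℝ) ≤ Real.exp (L * n) := by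
  set f : ℤ → ℝ := fun k => (1 / 2) ^ k.natAbs with hf
  have hf0 : ∀ k, 0 ≤ f k := fun k => by positivity
  have hs : Summable f := by
    refine Summable.of_nat_of_neg ?_ ?_ <;>
    simpa [hf] using summable_geometric_two
  set C := ∑' k, f k with hC
  have hC0 : 1 ≤ C := by
    have := hs.le_tsum 0 fun k _ => hf0 k
    rwa [show f 0 = 1 by simp [hf]] at this
  refine ⟨16 * Real.log 2 + Real.log C, ?_, fun n => ?_⟩
  · have := Real.log_nonneg hC0
    have := Real.log_nonneg one_le_two
    positivity
  have h1 : ∀ z ∈ intNet n, (1 : ℝ) ≤ 2 ^ (16 * n) * ∏ i, f (z i) := fun z hz => by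
    have hz2 : ∑ i, z i ^ 2 ≤ 16 * (n : ℤ) := (Finset.mem_filter.1 hz).2
    have h2 : ∑ i, (z i).natAbs ≤ 16 * n := by
      zify
      refine (Finset.sum_le_sum fun i _ => ?_).trans hz2
      rw [← sq_abs]
      nlinarith [abs_nonneg (z i), Int.le_self_sq |z i|]
    simp only [hf]
    rw [Finset.prod_pow_eq_pow_sum, one_div, inv_pow, ← div_eq_mul_inv, one_le_div (by positivity)]
    exact pow_le_pow_right₀ one_le_two h2
  calc ((intNet n).card : ℝ) = ∑ z ∈ intNet n, (1 : ℝ) := by simp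
    _ ≤ ∑ z ∈ intNet n, 2 ^ (16 * n) * ∏ i, f (z i) := Finset.sum_le_sum h1
    _ ≤ ∑ z ∈ Fintype.piFinset fun _ : Fin n => Finset.Icc (-(4 * n : ℤ)) (4 * n),
          2 ^ (16 * n) * ∏ i, f (z i) :=
        Finset.sum_le_sum_of_subset_of_nonneg (Finset.filter_subset _ _) fun z _ _ =>
          mul_nonneg (by positivity) (Finset.prod_nonneg fun i _ => hf0 _)
    _ = 2 ^ (16 * n) * (∑ k ∈ Finset.Icc (-(4 * n : ℤ)) (4 * n), f k) ^ n := by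
        rw [← Finset.mul_sum, ← Finset.prod_univ_sum]
        simp
    _ ≤ 2 ^ (16 * n) * C ^ n := by
        gcongr
        exact hs.sum_le_tsum _ fun k _ => hf0 k
    _ = Real.exp ((16 * Real.log 2 + Real.log C) * n) := by
        rw [show (16 * Real.log 2 + Real.log C) * n =
            ((16 * n : ℕ) : ℝ) * Real.log 2 + (n : ℝ) * Real.log C by push_cast; ring,
          Real.exp_add, Real.exp_nat_mul, Real.exp_nat_mul, Real.exp_log two_pos,
          Real.exp_log (by linarith)]

/-- Rounding `4√n x` towards zero does not leave the ball and moves each coordinate by at most 1, so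
the distance after rescaling is at most `√n / (4√n)`. -/
theorem exists_mem_intNet {n : ℕ} (hn : 0 < n) {x : EuclideanSpace ℝ (Fin n)} (hx : ‖x‖ ≤ 1) :
    ∃ z ∈ intNet n, ‖x - netVec z‖ ≤ 1 / 4 := by
  have hn0 : 0 < √(n : ℝ) := Real.sqrt_pos.2 (by exact_mod_cast hn)
  have hx2 : ∑ i, x i ^ 2 ≤ 1 := by
    have := EuclideanSpace.norm_sq_eq x
    simp only [Real.norm_eq_abs, sq_abs] at this
    rw [← this]
    exact pow_le_one₀ (norm_nonneg _) hx
  -- round every coordinate towards zero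
  have hround : ∀ y : ℝ, ∃ k : ℤ, (k : ℝ) ^ 2 ≤ y ^ 2 ∧ (y - k) ^ 2 ≤ 1 := fun y => by
    rcases le_total 0 y with hy | hy
    · have h1 : (0 : ℝ) ≤ ⌊y⌋ := by exact_mod_cast Int.floor_nonneg.2 hy
      refine ⟨⌊y⌋, ?_, ?_⟩ <;> nlinarith [Int.floor_le y, Int.lt_floor_add_one y]
    · have h1 : (⌈y⌉ : ℝ) ≤ 0 := by exact_mod_cast Int.ceil_nonpos.2 hy
      refine ⟨⌈y⌉, ?_, ?_⟩ <;> nlinarith [Int.le_ceil y, Int.ceil_lt_add_one y]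
  choose r hr1 hr2 using hround
  set z : Fin n → ℤ := fun i => r (4 * √n * x i) with hz
  have hz2 : ∑ i, z i ^ 2 ≤ 16 * (n : ℤ) := by
    have : ∑ i, (z i : ℝ) ^ 2 ≤ 16 * n := by
      calc ∑ i, (z i : ℝ) ^ 2 ≤ ∑ i, (4 * √n * x i) ^ 2 := Finset.sum_le_sum fun i _ => hr1 _
        _ = 16 * n * ∑ i, x i ^ 2 := by
          rw [Finset.mul_sum]
          refine Finset.sum_congr rfl fun i _ => ?_
          rw [mul_pow, mul_pow, Real.sq_sqrt (Nat.cast_nonneg n)]; norm_num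
        _ ≤ 16 * n := mul_le_of_le_one_right (by positivity) hx2
    exact_mod_cast this
  refine ⟨z, Finset.mem_filter.2 ⟨Fintype.mem_piFinset.2 fun i => ?_, hz2⟩, ?_⟩
  · have h1 : z i ^ 2 ≤ 16 * (n : ℤ) :=
      (Finset.single_le_sum (f := fun i => z i ^ 2) (fun j _ => sq_nonneg _)
        (Finset.mem_univ i)).trans hz2
    have h2 : (1 : ℤ) ≤ n := by exact_mod_cast hn
    rw [Finset.mem_Icc]
    exact abs_le.1 (abs_le_of_sq_le_sq (by nlinarith) (by positivity))
  · rw [← abs_of_nonneg (norm_nonneg (x - netVec z))]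
    refine abs_le_of_sq_le_sq ?_ (by norm_num)
    rw [EuclideanSpace.norm_sq_eq]
    calc ∑ i, ‖(x - netVec z) i‖ ^ 2 = ∑ i, (4 * √n * x i - z i) ^ 2 / (16 * n) := by
          refine Finset.sum_congr rfl fun i _ => ?_
          have : (n : ℝ) = √n * √n := (Real.mul_self_sqrt (Nat.cast_nonneg n)).symm
          rw [Real.norm_eq_abs, sq_abs, this]
          simp only [PiLp.sub_apply, netVec, ← this]
          field_simp
          rw [Real.sq_sqrt (Nat.cast_nonneg n)]
          ring
      _ ≤ ∑ i : Fin n, 1 / (16 * n : ℝ) := by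
          gcongr with i
          exact hr2 _
      _ = (1 / 4) ^ 2 := by
          have : (n : ℝ) ≠ 0 := by positivity
          simp
          field_simp
          norm_num

/-- Moving each of the two arguments to the net costs `‖T‖ / 4`; the total `‖T‖ / 2` is absorbed on
the left. -/
theorem opNorm_le_of_intNet {n : ℕ} (hn : 0 < n)
    (T : EuclideanSpace ℝ (Fin n) →L[ℝ] EuclideanSpace ℝ (Fin n)) {t : ℝ} (ht : 0 ≤ t)
    (h : ∀ z ∈ intNet n, ∀ w ∈ intNet n, |inner ℝ (netVec z) (T (netVec w))| ≤ t) :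
    ‖T‖ ≤ 2 * t := by
  suffices ‖T‖ ≤ t + ‖T‖ / 2 by linarith
  have key : ∀ x y : EuclideanSpace ℝ (Fin n), ‖x‖ ≤ 1 → ‖y‖ ≤ 1 →
      inner ℝ x (T y) ≤ t + ‖T‖ / 2 := fun x y hx hy => by
    obtain ⟨z, hz, hxz⟩ := exists_mem_intNet hn hx
    obtain ⟨w, hw, hyw⟩ := exists_mem_intNet hn hy
    have hz1 : ‖netVec z‖ ≤ 1 := norm_netVec_le (Finset.mem_filter.1 hz).2
    have e : inner ℝ x (T y) = inner ℝ (netVec z) (T (netVec w)) +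
        inner ℝ (netVec z) (T (y - netVec w)) + inner ℝ (x - netVec z) (T y) := by
      simp only [map_sub, inner_sub_left, inner_sub_right]; ring
    have h1 := (abs_le.1 (h z hz w hw)).2
    have h2 : inner ℝ (netVec z) (T (y - netVec w)) ≤ ‖T‖ / 4 := by
      refine (real_inner_le_norm _ _).trans ?_
      calc _ ≤ 1 * (‖T‖ * (1 / 4)) := by
            gcongr; exact (T.le_opNorm _).trans (by gcongr)
        _ = _ := by ring
    have h3 : inner ℝ (x - netVec z) (T y) ≤ ‖T‖ / 4 := by
      refine (real_inner_le_norm _ _).trans ?_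
      calc _ ≤ (1 / 4) * (‖T‖ * 1) := by
            gcongr; exact (T.le_opNorm _).trans (by gcongr)
        _ = _ := by ring
    rw [e]; linarith
  refine T.opNorm_le_of_unit_norm (by positivity) fun y hy => ?_
  by_cases h0 : T y = 0
  · rw [h0, norm_zero]; positivity
  have h1 := key (‖T y‖⁻¹ • T y) y (by rw [norm_smul, norm_inv, norm_norm,
    inv_mul_cancel₀ (norm_ne_zero_iff.2 h0)]) hy.le
  rwa [real_inner_smul_left, real_inner_self_eq_norm_sq, pow_two, ← mul_assoc,
    inv_mul_cancel₀ (norm_ne_zero_iff.2 h0), one_mul] at h1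

/-- The operator norm of the noise is of order `√n`, up to an event of exponentially small
probability. -/
theorem exists_law_norm_noiseOp_gt_le (p q : I) : ∃ C : ℝ, 0 < C ∧ ∀ n : ℕ, 0 < n →
    (law n p q).real {G | C * √n < ‖noiseOp p q G‖} ≤ 2 * Real.exp (-n) := by
  obtain ⟨L, hL, hcard⟩ := exists_card_intNet_le
  -- The tail `exp(-t² n)` has to beat the `exp(2Ln)` pairs of net points and leave `exp(-n)`.
  set t : ℝ := √(2 * L + 1) with ht
  have ht0 : 0 < t := Real.sqrt_pos.2 (by positivity)
  refine ⟨2 * t, by positivity, fun n hn => ?_⟩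
  have hsub : {G | 2 * t * √n < ‖noiseOp p q G‖} ⊆
      ⋃ zw ∈ intNet n ×ˢ intNet n, {G : SimpleGraph (Fin n) |
        t * √n ≤ |inner ℝ (netVec zw.1) (noiseOp p q G (netVec zw.2))|} := fun G hG => by
    by_contra hcon
    simp only [Set.mem_iUnion, Set.mem_ofPred_eq, not_exists, not_le, Finset.mem_product,
      Prod.forall] at hcon hG
    have := opNorm_le_of_intNet hn (noiseOp p q G) (t := t * √n) (by positivity)
      fun z hz w hw => (hcon z w ⟨hz, hw⟩).le
    linarith
  refine (measureReal_mono hsub (measure_ne_top _ _)).trans ?_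
  refine (measureReal_biUnion_finset_le _ _).trans ?_
  calc _ ≤ ∑ zw ∈ intNet n ×ˢ intNet n, 2 * Real.exp (-(t * √n) ^ 2) := by
        refine Finset.sum_le_sum fun zw hzw => ?_
        rw [Finset.mem_product] at hzw
        exact law_abs_inner_noiseOp_ge_le p q (norm_netVec_le (Finset.mem_filter.1 hzw.1).2)
          (norm_netVec_le (Finset.mem_filter.1 hzw.2).2) (by positivity)
    _ = (intNet n).card * (intNet n).card * (2 * Real.exp (-((2 * L + 1) * n))) := by
        rw [Finset.sum_const, Finset.card_product, nsmul_eq_mul, mul_pow, ht,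
          Real.sq_sqrt (by positivity), Real.sq_sqrt (Nat.cast_nonneg n)]
        push_cast; rfl
    _ ≤ Real.exp (L * n) * Real.exp (L * n) * (2 * Real.exp (-((2 * L + 1) * n))) := by
        gcongr <;> exact hcard n
    _ = 2 * Real.exp (-n) := by
        rw [mul_left_comm, ← Real.exp_add, ← Real.exp_add]
        ring_nf

/-! ### Eigenvectors of perturbed operators of rank two. -/

section Deterministic

open scoped RealInnerProductSpace

variable {E : Type*} [NormedAddCommGroup E] [InnerProductSpace ℝ E]

/-- A nontrivial combination of two orthonormal vectors orthogonal to a given vector. -/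
theorem exists_combination_orthogonal {x y : E} (hx : ‖x‖ = 1) (hy : ‖y‖ = 1) (hxy : ⟪x, y⟫ = 0)
    (w : E) : ∃ α β : ℝ, ⟪w, α • x + β • y⟫ = 0 ∧ α ^ 2 + β ^ 2 = 1 ∧
      ‖α • x + β • y‖ = 1 := by
  have hnorm : ∀ α β : ℝ, ‖α • x + β • y‖ ^ 2 = α ^ 2 + β ^ 2 := fun α β => by
    rw [norm_add_sq_real, norm_smul, norm_smul, hx, hy, real_inner_smul_left,
      real_inner_smul_right, hxy]
    simp
  suffices ∃ α β : ℝ, ⟪w, α • x + β • y⟫ = 0 ∧ α ^ 2 + β ^ 2 = 1 by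
    obtain ⟨α, β, h1, h2⟩ := this
    refine ⟨α, β, h1, h2, ?_⟩
    have := hnorm α β
    rw [h2] at this
    exact (pow_eq_one_iff_of_nonneg (norm_nonneg _) two_ne_zero).1 this
  by_cases h0 : ⟪w, x⟫ = 0
  · exact ⟨1, 0, by simp [h0], by simp⟩
  set r := √(⟪w, x⟫ ^ 2 + ⟪w, y⟫ ^ 2) with hr
  have hpos : 0 < ⟪w, x⟫ ^ 2 + ⟪w, y⟫ ^ 2 := by positivity
  have hr2 : r ^ 2 = ⟪w, x⟫ ^ 2 + ⟪w, y⟫ ^ 2 := Real.sq_sqrt hpos.le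
  have hr0 : r ≠ 0 := (Real.sqrt_pos.2 hpos).ne'
  refine ⟨⟪w, y⟫ / r, -⟪w, x⟫ / r, ?_, ?_⟩
  · rw [inner_add_right, real_inner_smul_right, real_inner_smul_right]; ring
  · field_simp
    rw [hr2]; ring

/-- Weyl's inequality for the second eigenvalue `μ` of a perturbation `R` of an operator of rank
two. -/
theorem abs_second_eigenvalue_sub_le {A R : E →ₗ[ℝ] E} {u g f₁ f₂ : E} {a b M l₁ μ : ℝ}
    (hu : ‖u‖ = 1) (hg : ‖g‖ = 1) (hug : ⟪u, g⟫ = 0)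
    (hA : ∀ x, A x = (a * ⟪u, x⟫) • u + (b * ⟪g, x⟫) • g + R x) (hab : b ≤ a)
    (hR : ∀ x, ‖R x‖ ≤ M * ‖x‖)
    (hf₁ : ‖f₁‖ = 1) (hf₂ : ‖f₂‖ = 1) (hf : ⟪f₁, f₂⟫ = 0) (hA₁ : A f₁ = l₁ • f₁)
    (hA₂ : A f₂ = μ • f₂) (hμ : μ ≤ l₁)
    (hmax : ∀ x, ⟪f₁, x⟫ = 0 → ⟪x, A x⟫ ≤ μ * ‖x‖ ^ 2) (hb : 0 ≤ b) : |μ - b| ≤ M := by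
  have hquad : ∀ x, ⟪x, A x⟫ = a * ⟪u, x⟫ ^ 2 + b * ⟪g, x⟫ ^ 2 + ⟪x, R x⟫ := fun x => by
    rw [hA, inner_add_right, inner_add_right, real_inner_smul_right, real_inner_smul_right,
      real_inner_comm u, real_inner_comm g]
    ring
  have hRx : ∀ x, ‖x‖ = 1 → |⟪x, R x⟫| ≤ M := fun x hx => by
    have := (abs_real_inner_le_norm x (R x)).trans
      (mul_le_mul_of_nonneg_left (hR x) (norm_nonneg x))
    simpa [hx] using this
  have huu : ⟪u, u⟫ = 1 := by rw [real_inner_self_eq_norm_sq, hu, one_pow]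
  have hgg : ⟪g, g⟫ = 1 := by rw [real_inner_self_eq_norm_sq, hg, one_pow]
  have hgu : ⟪g, u⟫ = 0 := by rw [real_inner_comm]; exact hug
  rw [abs_le]
  constructor
  -- A unit vector of `span {u, g}` orthogonal to `f₁`: the form of `A` is at least `b - M` there,
  -- and at most `μ`.
  · obtain ⟨α, β, h0, h1, hn⟩ := exists_combination_orthogonal hu hg hug f₁
    have h2 := hmax _ h0
    have h3 := abs_le.1 (hRx _ hn)
    rw [hquad, hn] at h2
    simp only [inner_add_right, real_inner_smul_right, huu, hgg, hgu, hug] at h2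
    nlinarith [mul_nonneg (sub_nonneg.2 hab) (sq_nonneg α)]
  -- A unit vector of `span {f₁, f₂}` orthogonal to `u`: the form is at least `μ` there, and at most
  -- `b + M`.
  · obtain ⟨α, β, h0, h1, hn⟩ := exists_combination_orthogonal hf₁ hf₂ hf u
    set x := α • f₁ + β • f₂ with hx
    have h2 : ⟪x, A x⟫ = l₁ * α ^ 2 + μ * β ^ 2 := by
      have hf' : ⟪f₂, f₁⟫ = 0 := by rw [real_inner_comm]; exact hf
      simp only [hx, map_add, map_smul, hA₁, hA₂, inner_add_right, inner_add_left,
        real_inner_smul_right, real_inner_smul_left, hf, hf', real_inner_self_eq_norm_sq, hf₁, hf₂]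
      ring
    have h3 := abs_le.1 (hRx _ hn)
    have h4 := hquad x
    rw [h0] at h4
    have h5 : ⟪g, x⟫ ^ 2 ≤ 1 := by
      rw [sq_le_one_iff_abs_le_one]
      simpa [hg, hn] using abs_real_inner_le_norm g x
    nlinarith [mul_nonneg (sub_nonneg.2 hμ) (sq_nonneg α), mul_nonneg hb (sub_nonneg.2 h5)]

/-- An eigenvector of a perturbed operator of rank two has small components off the unperturbed
one. -/
theorem eigenvector_components_le {A R : E →ₗ[ℝ] E} {u g v : E} {a b M γ μ : ℝ}
    (hu : ‖u‖ = 1) (hg : ‖g‖ = 1) (hug : ⟪u, g⟫ = 0)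
    (hA : ∀ x, A x = (a * ⟪u, x⟫) • u + (b * ⟪g, x⟫) • g + R x)
    (hR : ∀ x, ‖R x‖ ≤ M * ‖x‖) (hM : 0 ≤ M) 
    (hγ : 0 < γ) (hμγ : γ ≤ μ) (haμ : γ ≤ a - μ) 
    (hv : A v = μ • v) :
    ‖v‖ ^ 2 ≤ ⟪g, v⟫ ^ 2 + 2 * ((M / γ) ^ 2 * ‖v‖ ^ 2) ∧
      ‖v - g‖ ^ 2 ≤ (⟪g, v⟫ - 1) ^ 2 + 2 * ((M / γ) ^ 2 * ‖v‖ ^ 2) := by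
  set δ := M / γ with hδ
  have hδ0 : 0 ≤ δ := by positivity
  have hδγ : M = δ * γ := by rw [hδ]; field_simp
  have huu : ⟪u, u⟫ = 1 := by rw [real_inner_self_eq_norm_sq, hu, one_pow]
  have hgg : ⟪g, g⟫ = 1 := by rw [real_inner_self_eq_norm_sq, hg, one_pow]
  have hgu : ⟪g, u⟫ = 0 := by rw [real_inner_comm]; exact hug
  set α := ⟪g, v⟫ with hα
  set β := ⟪u, v⟫ with hβ
  set w := v - α • g - β • u with hw
  have hvw : v = α • g + β • u + w := by rw [hw]; abel
  have hwg : ⟪g, w⟫ = 0 := by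
    simp only [hw, inner_sub_right, real_inner_smul_right, hgg, hgu, ← hα]
    ring
  have hwu : ⟪u, w⟫ = 0 := by
    simp only [hw, inner_sub_right, real_inner_smul_right, huu, hug, ← hβ]
    ring
  have hwg' : ⟪w, g⟫ = 0 := by rw [real_inner_comm]; exact hwg
  have hwu' : ⟪w, u⟫ = 0 := by rw [real_inner_comm]; exact hwu
  have hnsq : ∀ s t : ℝ, ‖s • g + t • u + w‖ ^ 2 = s ^ 2 + t ^ 2 + ‖w‖ ^ 2 := fun s t => by
    rw [← real_inner_self_eq_norm_sq, ← real_inner_self_eq_norm_sq]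
    simp only [inner_add_left, inner_add_right, real_inner_smul_left, real_inner_smul_right, hgg,
      huu, hug, hgu, hwg, hwu, hwg', hwu']
    ring
  have hnv2 : ‖v‖ ^ 2 = α ^ 2 + β ^ 2 + ‖w‖ ^ 2 := by rw [← hnsq, ← hvw]
  have huv : μ * β = a * β + ⟪u, R v⟫ := by
    have h := congrArg (fun y => ⟪u, y⟫) hv
    simp only [hA, inner_add_right, real_inner_smul_right, huu, hug, ← hβ] at h
    linarith
  have hβle : |β| ≤ δ * ‖v‖ := by
    have h1 : (a - μ) * |β| ≤ M * ‖v‖ := by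
      rw [← abs_of_nonneg (hγ.le.trans haμ), ← abs_mul, show (a - μ) * β = -⟪u, R v⟫ by linarith,
        abs_neg]
      refine (abs_real_inner_le_norm _ _).trans ?_
      rw [hu, one_mul]; exact hR v
    have h2 := mul_le_mul_of_nonneg_right haμ (abs_nonneg β)
    rw [hδγ] at h1
    exact le_of_mul_le_mul_left (by linarith) hγ
  have hwle : ‖w‖ ≤ δ * ‖v‖ := by
    by_cases hw0 : ‖w‖ = 0
    · rw [hw0]; positivity
    -- Pairing with `w` kills the rank-two part and leaves `μ‖w‖² = ⟪w, R v⟫`.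
    have h := congrArg (fun y => ⟪w, y⟫) hv
    simp only [hA, inner_add_right, real_inner_smul_right, hwg', hwu'] at h
    have h1 : ⟪w, v⟫ = ‖w‖ ^ 2 := by
      conv_lhs => rw [hvw]
      simp [inner_add_right, real_inner_smul_right, hwg', hwu']
    rw [h1] at h
    have h2 : ⟪w, R v⟫ ≤ ‖w‖ * (M * ‖v‖) :=
      (real_inner_le_norm _ _).trans (mul_le_mul_of_nonneg_left (hR v) (norm_nonneg w))
    have h3 : γ * ‖w‖ ^ 2 ≤ μ * ‖w‖ ^ 2 := mul_le_mul_of_nonneg_right hμγ (sq_nonneg _)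
    have hwpos : 0 < ‖w‖ := lt_of_le_of_ne (norm_nonneg w) (Ne.symm hw0)
    rw [hδγ] at h2
    refine le_of_mul_le_mul_left (a := γ * ‖w‖) ?_ (by positivity)
    nlinarith
  have hβ2 : β ^ 2 ≤ δ ^ 2 * ‖v‖ ^ 2 := by
    rw [← mul_pow, ← sq_abs β]; exact pow_le_pow_left₀ (abs_nonneg _) hβle 2
  have hw2 : ‖w‖ ^ 2 ≤ δ ^ 2 * ‖v‖ ^ 2 := by
    rw [← mul_pow]; exact pow_le_pow_left₀ (norm_nonneg _) hwle 2
  have hen : ‖v - g‖ ^ 2 = (α - 1) ^ 2 + β ^ 2 + ‖w‖ ^ 2 := by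
    rw [← hnsq]
    congr 2
    conv_lhs => rw [hvw]
    module
  constructor <;> linarith

/-- A normalised eigenvector of a perturbed operator of rank two is close to the unperturbed
one. -/
theorem eigenvector_near {A R : E →ₗ[ℝ] E} {u g v : E} {a b M γ μ : ℝ}
    (hu : ‖u‖ = 1) (hg : ‖g‖ = 1) (hug : ⟪u, g⟫ = 0)
    (hA : ∀ x, A x = (a * ⟪u, x⟫) • u + (b * ⟪g, x⟫) • g + R x)
    (hR : ∀ x, ‖R x‖ ≤ M * ‖x‖) (hM : 0 ≤ M) 
    (hγ : 0 < γ) (hMγ : 4 * M ≤ γ) (hμγ : γ ≤ μ) (haμ : γ ≤ a - μ) 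
    (hv : A v = μ • v) (hnv : (‖v‖ = 1 ∧ 0 ≤ ⟪g, v⟫) ∨ ⟪g, v⟫ = 1) :
    |⟪g, v⟫ - 1| ≤ 2 * (M / γ) ^ 2 ∧ ‖v - g‖ ≤ 2 * (M / γ) := by
  obtain ⟨h1, h2⟩ := eigenvector_components_le hu hg hug hA hR hM hγ hμγ haμ hv
  set δ := M / γ with hδ
  have hδ0 : 0 ≤ δ := by positivity
  have hδ1 : δ ≤ 1 / 4 := by rw [hδ, div_le_iff₀ hγ]; linarith
  have hδ2 : δ ^ 2 ≤ 1 / 16 := by nlinarith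
  set α := ⟪g, v⟫
  suffices |α - 1| ≤ 2 * δ ^ 2 ∧ ‖v - g‖ ^ 2 ≤ (2 * δ) ^ 2 by
    refine ⟨this.1, ?_⟩
    have := abs_le_of_sq_le_sq this.2 (by positivity)
    rwa [abs_of_nonneg (norm_nonneg _)] at this
  rcases hnv with ⟨h3, h4⟩ | h3
  · have h5 : α ≤ 1 := by
      have := real_inner_le_norm g v
      rwa [hg, h3, one_mul] at this
    rw [h3] at h1 h2
    -- From `0 ≤ α ≤ 1`: `1 - α ≤ 1 - α² ≤ 2δ²`.
    have h6 : 1 - α ≤ 2 * δ ^ 2 := by nlinarith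
    refine ⟨by rw [abs_sub_comm, abs_of_nonneg (by linarith)]; exact h6, ?_⟩
    nlinarith
  · rw [h3] at h1 h2
    -- The length is not prescribed in this case, but `‖v‖² ≤ 1 + ‖v‖² / 8`.
    have h4 : ‖v‖ ^ 2 ≤ 2 := by
      have := mul_le_mul_of_nonneg_right hδ2 (sq_nonneg ‖v‖)
      linarith
    refine ⟨by rw [h3, sub_self, abs_zero]; positivity, ?_⟩
    have := mul_le_mul_of_nonneg_left h4 (sq_nonneg δ)
    linarith

/-- An eigenvector of a perturbed operator of rank two, expanded around the unperturbed one. -/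
theorem norm_sub_first_order_le {A R : E →ₗ[ℝ] E} {u g v : E} {a b M γ τ μ : ℝ}
    (hu : ‖u‖ = 1) (hg : ‖g‖ = 1) (hug : ⟪u, g⟫ = 0)
    (hA : ∀ x, A x = (a * ⟪u, x⟫) • u + (b * ⟪g, x⟫) • g + R x)
    (hR : ∀ x, ‖R x‖ ≤ M * ‖x‖) (hτ : |⟪u, R g⟫| ≤ τ) (hM : 0 ≤ M) (hb : 0 < b) (ha : 0 ≤ a)
    (hγ : 0 < γ) (hMγ : 4 * M ≤ γ) (hμγ : γ ≤ μ) (haμ : γ ≤ a - μ) (hμb : |μ - b| ≤ M)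
    (hv : A v = μ • v) (hnv : (‖v‖ = 1 ∧ 0 ≤ ⟪g, v⟫) ∨ ⟪g, v⟫ = 1) :
    ‖(v - g) - b⁻¹ • (A g - μ • g)‖ ≤
      4 * M * (M / γ) / b + a / b * ((τ + 2 * M * (M / γ)) / γ) + 2 * (M / γ) ^ 2 := by
  obtain ⟨hαle, hele⟩ := eigenvector_near hu hg hug hA hR hM hγ hMγ hμγ haμ hv hnv
  set δ := M / γ with hδ
  have hδ0 : 0 ≤ δ := by positivity
  have huu : ⟪u, u⟫ = 1 := by rw [real_inner_self_eq_norm_sq, hu, one_pow]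
  have hgg : ⟪g, g⟫ = 1 := by rw [real_inner_self_eq_norm_sq, hg, one_pow]
  set α := ⟪g, v⟫
  set β := ⟪u, v⟫ with hβ
  have huv : μ * β = a * β + ⟪u, R v⟫ := by
    have h := congrArg (fun y => ⟪u, y⟫) hv
    simp only [hA, inner_add_right, real_inner_smul_right, huu, hug, ← hβ] at h
    linarith
  set e := v - g with he
  have hge : ⟪g, e⟫ = α - 1 := by rw [he, inner_sub_right, hgg]
  have hue : ⟪u, e⟫ = β := by rw [he, inner_sub_right, hug, sub_zero]
  -- The coarse bound of order `δ` on `β` is too weak. Splitting `R v = R g + R e` brings in `τ` and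
  -- the second-order `M‖e‖`.
  have hβfine : |β| ≤ (τ + 2 * M * δ) / γ := by
    rw [le_div_iff₀ hγ]
    have h1 : (a - μ) * |β| ≤ τ + 2 * M * δ := by
      rw [← abs_of_nonneg (hγ.le.trans haμ), ← abs_mul,
        show (a - μ) * β = -(⟪u, R g⟫ + ⟪u, R e⟫) by
          rw [← inner_add_right, ← map_add, he, add_sub_cancel]; linarith, abs_neg]
      refine (abs_add_le _ _).trans (add_le_add hτ ((abs_real_inner_le_norm _ _).trans ?_))
      rw [hu, one_mul]
      refine (hR e).trans ?_
      calc M * ‖e‖ ≤ M * (2 * δ) := by gcongr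
        _ = _ := by ring
    nlinarith [mul_le_mul_of_nonneg_right haμ (abs_nonneg β)]
  have hid : e - b⁻¹ • (A g - μ • g) =
      b⁻¹ • ((b - μ) • e + R e) + ((a / b * β) • u + (α - 1) • g) := by
    have h1 : A g - μ • g = μ • e - A e := by
      rw [he, map_sub, hv]; module
    rw [h1, hA e, hue, hge, ← smul_right_injective E hb.ne' |>.eq_iff]
    simp only [smul_add, smul_sub, smul_smul]
    field_simp
    module
  rw [hid]
  calc _ ≤ ‖b⁻¹ • ((b - μ) • e + R e)‖ + (‖(a / b * β) • u‖ + ‖(α - 1) • g‖) :=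
        (norm_add_le _ _).trans (add_le_add le_rfl (norm_add_le _ _))
    _ ≤ 4 * M * δ / b + (a / b * ((τ + 2 * M * δ) / γ) + 2 * δ ^ 2) := by
        gcongr
        · rw [norm_smul, Real.norm_of_nonneg (by positivity), inv_mul_eq_div]
          gcongr
          refine (norm_add_le _ _).trans ?_
          rw [norm_smul, Real.norm_eq_abs, abs_sub_comm]
          calc _ ≤ M * (2 * δ) + M * (2 * δ) :=
                add_le_add (by gcongr) ((hR e).trans (by gcongr))
            _ = _ := by ring
        · rw [norm_smul, hu, mul_one, Real.norm_eq_abs, abs_mul, abs_of_nonneg (by positivity)]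
          gcongr
        · rwa [norm_smul, hg, mul_one, Real.norm_eq_abs]
    _ = _ := by ring

end Deterministic

/-! ### The block model as a perturbation of rank two. -/

section BlockModel

open scoped RealInnerProductSpace

/-- The normalised constant vector. -/
noncomputable def unitOnes (n : ℕ) : EuclideanSpace ℝ (Fin n) :=
  (√(n : ℝ))⁻¹ • WithLp.toLp 2 fun _ => 1

/-- The normalised group vector. -/
noncomputable def unitGroupVec (n : ℕ) : EuclideanSpace ℝ (Fin n) :=
  (√(n : ℝ))⁻¹ • groupVec n

theorem unitOnes_apply {n : ℕ} (i : Fin n) : unitOnes n i = (√(n : ℝ))⁻¹ := by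
  simp [unitOnes]

theorem unitGroupVec_apply {n : ℕ} (i : Fin n) :
    unitGroupVec n i = (√(n : ℝ))⁻¹ * groupVec n i := by
  simp [unitGroupVec]

theorem groupVec_sq {n : ℕ} (i : Fin n) : groupVec n i ^ 2 = 1 := by
  simp only [groupVec]
  split_ifs <;> norm_num

theorem sum_groupVec {n : ℕ} (hn : Even n) : ∑ i, groupVec n i = 0 := by
  obtain ⟨k, rfl⟩ := hn
  have h : (k + k) / 2 = k := by omega
  simp only [groupVec, h]
  rw [Fin.sum_univ_eq_sum_range (fun i => if i < k then (1 : ℝ) else -1), Finset.sum_range_add,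
    Finset.sum_congr rfl fun i hi => if_pos (Finset.mem_range.1 hi)]
  simp

theorem inv_sqrt_sq (n : ℕ) : ((√(n : ℝ))⁻¹) ^ 2 = (n : ℝ)⁻¹ := by
  rw [inv_pow, Real.sq_sqrt (Nat.cast_nonneg n)]

theorem norm_unitOnes {n : ℕ} (hn : 0 < n) : ‖unitOnes n‖ = 1 := by
  rw [← pow_eq_one_iff_of_nonneg (norm_nonneg _) two_ne_zero, EuclideanSpace.norm_sq_eq]
  simp only [unitOnes_apply, Real.norm_eq_abs, sq_abs, inv_sqrt_sq]
  have : (n : ℝ) ≠ 0 := by positivity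
  simp [this]

theorem norm_unitGroupVec {n : ℕ} (hn : 0 < n) : ‖unitGroupVec n‖ = 1 := by
  rw [← pow_eq_one_iff_of_nonneg (norm_nonneg _) two_ne_zero, EuclideanSpace.norm_sq_eq]
  simp only [unitGroupVec_apply, Real.norm_eq_abs, sq_abs, mul_pow, groupVec_sq, inv_sqrt_sq]
  have : (n : ℝ) ≠ 0 := by positivity
  simp [this]

theorem inner_unitOnes {n : ℕ} (x : EuclideanSpace ℝ (Fin n)) :
    ⟪unitOnes n, x⟫ = (√(n : ℝ))⁻¹ * ∑ j, x j := by
  simp only [PiLp.inner_apply, unitOnes_apply, Finset.mul_sum]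
  exact Finset.sum_congr rfl fun j _ => by simp [mul_comm]

theorem inner_unitGroupVec {n : ℕ} (x : EuclideanSpace ℝ (Fin n)) :
    ⟪unitGroupVec n, x⟫ = (√(n : ℝ))⁻¹ * ∑ j, groupVec n j * x j := by
  simp only [PiLp.inner_apply, unitGroupVec_apply, Finset.mul_sum]
  refine Finset.sum_congr rfl fun j _ => ?_
  simp
  ring

theorem inner_unitOnes_unitGroupVec {n : ℕ} (hn : Even n) :
    ⟪unitOnes n, unitGroupVec n⟫ = 0 := by
  rw [inner_unitOnes]
  simp only [unitGroupVec_apply]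
  rw [← Finset.mul_sum, sum_groupVec hn, mul_zero, mul_zero]

/-- The product of two entries of the group vector is 1 within a group and -1 across, so the matrix
of probabilities has rank two. -/
theorem edgeProb_mk {n : ℕ} (p q : I) (i j : Fin n) :
    (edgeProb n p q s(i, j) : ℝ) =
      ((p : ℝ) + q) / 2 + ((p : ℝ) - q) / 2 * groupVec n i * groupVec n j := by
  simp only [edgeProb, Sym2.lift_mk, groupVec]
  by_cases hi : (i : ℕ) < n / 2 <;> by_cases hj : (j : ℕ) < n / 2 <;> simp [hi, hj] <;> ring

/-- The perturbation of the operator of rank two: the noise and a multiple of the identity. -/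
noncomputable def perturbation {n : ℕ} (p q : I) (G : SimpleGraph (Fin n)) :
    EuclideanSpace ℝ (Fin n) →ₗ[ℝ] EuclideanSpace ℝ (Fin n) :=
  (noiseOp p q G).toLinearMap - (p : ℝ) • LinearMap.id

-- The rank-two matrix carries `p` on its diagonal and the adjacency matrix carries 0; hence the
-- correction.
open scoped Classical in
theorem adjMatrix_eq {n : ℕ} (p q : I) (G : SimpleGraph (Fin n)) (i j : Fin n) :
    G.adjMatrix ℝ i j = ((p : ℝ) + q) / 2 + ((p : ℝ) - q) / 2 * groupVec n i * groupVec n j +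
      noise p q G i j - if i = j then (p : ℝ) else 0 := by
  rw [← edgeProb_mk]
  by_cases h : i = j
  · subst h
    simp [noise, edgeProb]
  · simp [noise, h]

theorem adjOp_eq {n : ℕ} (hn : 0 < n) (p q : I) (G : SimpleGraph (Fin n))
    (x : EuclideanSpace ℝ (Fin n)) :
    adjOp G x = (((p : ℝ) + q) / 2 * n * ⟪unitOnes n, x⟫) • unitOnes n +
      (((p : ℝ) - q) / 2 * n * ⟪unitGroupVec n, x⟫) • unitGroupVec n + perturbation p q G x := by
  classical
  ext i
  have hn0 : (n : ℝ) * ((√(n : ℝ))⁻¹) ^ 2 = 1 := by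
    rw [inv_sqrt_sq]; exact mul_inv_cancel₀ (by positivity)
  have h1 : adjOp G x i = ∑ j, G.adjMatrix ℝ i j * x j := by
    simp only [adjOp, Matrix.toLpLin_apply, Matrix.mulVec, dotProduct]
  have h2 : noiseOp p q G x i = ∑ j, noise p q G i j * x j := by
    simp [noiseOp, Matrix.toLpLin_apply, Matrix.mulVec, dotProduct]
  have h3 : ∑ j, G.adjMatrix ℝ i j * x j = ((p : ℝ) + q) / 2 * ∑ j, x j +
      ((p : ℝ) - q) / 2 * groupVec n i * ∑ j, groupVec n j * x j +
      (∑ j, noise p q G i j * x j - p * x i) := by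
    have h4 : (p : ℝ) * x i = ∑ j, (if i = j then (p : ℝ) else 0) * x j := by
      simp [ite_mul]
    rw [h4, Finset.mul_sum, Finset.mul_sum, ← Finset.sum_sub_distrib, ← Finset.sum_add_distrib,
      ← Finset.sum_add_distrib]
    refine Finset.sum_congr rfl fun j _ => ?_
    rw [show G.adjMatrix ℝ i j = _ from adjMatrix_eq p q G i j]
    ring
  rw [h1, h3, ← h2]
  simp only [PiLp.add_apply, PiLp.smul_apply, smul_eq_mul, inner_unitOnes, inner_unitGroupVec,
    unitOnes_apply, unitGroupVec_apply, perturbation, LinearMap.sub_apply, PiLp.sub_apply,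
    LinearMap.smul_apply, LinearMap.id_apply, ContinuousLinearMap.coe_coe]
  linear_combination (-(((p : ℝ) + q) / 2 * ∑ j, x j) -
    ((p : ℝ) - q) / 2 * groupVec n i * ∑ j, groupVec n j * x j) * hn0

/-- Variational characterisation of the second eigenvalue of the adjacency matrix. -/
theorem exists_top_eigenvectors {n : ℕ} (hn : 1 < n) (G : SimpleGraph (Fin n)) :
    ∃ (f₁ f₂ : EuclideanSpace ℝ (Fin n)) (l₁ : ℝ), ‖f₁‖ = 1 ∧ ‖f₂‖ = 1 ∧ ⟪f₁, f₂⟫ = 0 ∧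
      adjOp G f₁ = l₁ • f₁ ∧ adjOp G f₂ = lambda2 G • f₂ ∧ lambda2 G ≤ l₁ ∧
      ∀ x, ⟪f₁, x⟫ = 0 → ⟪x, adjOp G x⟫ ≤ lambda2 G * ‖x‖ ^ 2 := by
  classical
  have hcard : 1 < Fintype.card (Fin n) := by simpa using hn
  have hT : (adjOp G).IsSymmetric :=
    Matrix.isSymmetric_toEuclideanLin_iff.mpr (SimpleGraph.isHermitian_adjMatrix _ _)
  have hfr : Module.finrank ℝ (EuclideanSpace ℝ (Fin n)) = Fintype.card (Fin n) :=
    finrank_euclideanSpace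
  set B := hT.eigenvectorBasis hfr
  set ev := hT.eigenvalues hfr
  set i₀ : Fin (Fintype.card (Fin n)) := ⟨0, by omega⟩
  set i₁ : Fin (Fintype.card (Fin n)) := ⟨1, hcard⟩
  have hev : Antitone ev := hT.eigenvalues_antitone hfr
  have hl : lambda2 G = ev i₁ := by
    rw [lambda2, dif_pos hcard]
    rfl
  have hB : ∀ i, adjOp G (B i) = ev i • B i := fun i => hT.apply_eigenvectorBasis hfr i
  refine ⟨B i₀, B i₁, ev i₀, B.orthonormal.1 _, B.orthonormal.1 _, B.orthonormal.2 ?_, hB _, ?_, ?_,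
    fun x hx => ?_⟩
  · simp [i₀, i₁]
  · rw [hl]; exact hB _
  · rw [hl]; exact hev (by simp [i₀, i₁, Fin.le_def])
  -- In the eigenbasis, orthogonality to `f₁` removes the only coordinate whose eigenvalue may
  -- exceed `λ₂`.
  · rw [hl, ← B.sum_inner_mul_inner, ← B.sum_sq_norm_inner_right x, Finset.mul_sum]
    refine Finset.sum_le_sum fun i _ => ?_
    rw [← hT, hB, real_inner_smul_left, real_inner_comm, Real.norm_eq_abs, sq_abs]
    by_cases hi : i = i₀
    · rw [hi, hx]; simp
    · have : i₁ ≤ i := by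
        rw [Fin.le_def]
        have : (i : ℕ) ≠ 0 := fun h => hi (Fin.ext h)
        simp only [i₁]; omega
      nlinarith [hev this, sq_nonneg ⟪B i, x⟫]

theorem norm_perturbation_le {n : ℕ} (hn : 0 < n) (p q : I) {G : SimpleGraph (Fin n)} {C : ℝ}
    (hG : ‖noiseOp p q G‖ ≤ C * √n) (x : EuclideanSpace ℝ (Fin n)) :
    ‖perturbation p q G x‖ ≤ (C + 1) * √n * ‖x‖ := by
  have h1 : (1 : ℝ) ≤ √n := Real.one_le_sqrt.2 (by exact_mod_cast hn)
  have h2 : ‖(p : ℝ) • x‖ ≤ √n * ‖x‖ := by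
    rw [norm_smul, Real.norm_of_nonneg p.2.1]
    exact mul_le_mul_of_nonneg_right (p.2.2.trans h1) (norm_nonneg x)
  have h3 : ‖noiseOp p q G x‖ ≤ C * √n * ‖x‖ :=
    ((noiseOp p q G).le_opNorm x).trans (mul_le_mul_of_nonneg_right hG (norm_nonneg x))
  calc _ ≤ ‖noiseOp p q G x‖ + ‖(p : ℝ) • x‖ := norm_sub_le _ _
    _ ≤ C * √n * ‖x‖ + √n * ‖x‖ := add_le_add h3 h2
    _ = _ := by ring

theorem mainTerm_eq {n : ℕ} (hn : 0 < n) (p q : ℝ) (G : SimpleGraph (Fin n)) :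
    mainTerm p q G = ((p - q) / 2 * n)⁻¹ •
      (adjOp G (unitGroupVec n) - lambda2 G • unitGroupVec n) := by
  have h1 : (n : ℝ) ^ (3 / 2 : ℝ) = n * √n := by
    rw [show (3 / 2 : ℝ) = 1 + 1 / 2 by norm_num, Real.rpow_add (by positivity), Real.rpow_one,
      Real.sqrt_eq_rpow]
  rw [mainTerm, unitGroupVec, map_smul, smul_comm (lambda2 G), ← smul_sub, smul_smul, h1]
  congr 1
  rw [mul_inv, inv_div, div_eq_mul_inv, mul_inv, mul_inv]
  ring

/-- The expansion of the second eigenvector on the event that the noise is small. -/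
theorem norm_e2_sub_mainTerm_le {n : ℕ} (hn : 1 < n) (hne : Even n) {p q : I} (hqp : q < p)
    {C κ τ : ℝ} (hC : 0 ≤ C) (hκ : 0 < κ) (hκ₁ : κ ≤ ((p : ℝ) - q) / 4) (hκ₂ : κ ≤ (q : ℝ) / 2)
    (hlarge : 4 * (C + 1) ≤ κ * √n) {G : SimpleGraph (Fin n)}
    (hG : ‖noiseOp p q G‖ ≤ C * √n)
    (hτ : |⟪unitOnes n, noiseOp p q G (unitGroupVec n)⟫| ≤ τ)
    {v : EuclideanSpace ℝ (Fin n)} (hv : IsSecondEigenvector G v) :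
    ‖e2 v - mainTerm (p : ℝ) (q : ℝ) G‖ ≤
      (4 * (C + 1) ^ 2 / (κ * (((p : ℝ) - q) / 2)) +
        ((p : ℝ) + q) / ((p : ℝ) - q) * ((τ + 2 * (C + 1) ^ 2 / κ) / κ) +
        2 * (C + 1) ^ 2 / κ ^ 2) / n := by
  have hn' : 0 < n := by omega
  have hnR : (0 : ℝ) < n := by exact_mod_cast hn'
  have hs : 0 < √(n : ℝ) := Real.sqrt_pos.2 hnR
  have hss : √(n : ℝ) * √n = n := Real.mul_self_sqrt hnR.le
  have hpq : (0 : ℝ) < p - q := sub_pos.2 hqp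
  have hq0 := q.2.1
  have hp0 := p.2.1
  set D := C + 1 with hD
  set M := D * √n with hM
  have hMκ : 4 * M ≤ κ * n := by
    have := mul_le_mul_of_nonneg_right hlarge hs.le
    rwa [mul_assoc κ, hss, mul_assoc] at this
  have hM0 : 0 ≤ M := by positivity
  have hR := norm_perturbation_le hn' p q hG
  have hug := inner_unitOnes_unitGroupVec hne
  have hκn₁ := mul_le_mul_of_nonneg_right hκ₁ hnR.le
  have hκn₂ := mul_le_mul_of_nonneg_right hκ₂ hnR.le
  have hκn : 0 < κ * n := by positivity
  have hW : |lambda2 G - ((p : ℝ) - q) / 2 * n| ≤ M := by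
    obtain ⟨f₁, f₂, l₁, h1, h2, h3, h4, h5, h6, h7⟩ := exists_top_eigenvectors hn G
    refine abs_second_eigenvalue_sub_le (norm_unitOnes hn') (norm_unitGroupVec hn') hug
      (adjOp_eq hn' p q G) ?_ hR h1 h2 h3 h4 h5 h6 h7 (by positivity)
    have := mul_nonneg hq0 hnR.le
    linarith
  have hW' := abs_le.1 hW
  -- The multiple of the identity drops out because the two unit vectors are orthogonal.
  have hτ' : |⟪unitOnes n, perturbation p q G (unitGroupVec n)⟫| ≤ τ := by
    have : ⟪unitOnes n, perturbation p q G (unitGroupVec n)⟫ =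
        ⟪unitOnes n, noiseOp p q G (unitGroupVec n)⟫ := by
      simp [perturbation, inner_sub_right, real_inner_smul_right, hug]
    rwa [this]
  have hnv : (‖v‖ = 1 ∧ 0 ≤ ⟪unitGroupVec n, v⟫) ∨ ⟪unitGroupVec n, v⟫ = 1 := by
    rw [unitGroupVec, real_inner_smul_left]
    refine hv.2.imp (fun h => ⟨h.1, mul_nonneg (by positivity) h.2⟩) fun h => ?_
    rw [h, inv_mul_cancel₀ hs.ne']
  -- The gap is `γ = κ n`: both `b` and `a - b = q n` are at least `2κn`, and `λ₂` is within `M ≤ κn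
  -- / 4` of `b`.
  have key := norm_sub_first_order_le (norm_unitOnes hn') (norm_unitGroupVec hn') hug
    (adjOp_eq hn' p q G) hR hτ' hM0 (by positivity) (by positivity) hκn hMκ
    (by linarith) (by linarith) hW hv.1 hnv
  rw [mainTerm_eq hn', e2]
  refine key.trans_eq ?_
  have h1 : M * (M / (κ * n)) = D ^ 2 / κ := by
    rw [show M * (M / (κ * n)) = D ^ 2 * (√n * √n) / (κ * n) by rw [hM]; ring, hss]
    field_simp
  have h2 : (M / (κ * n)) ^ 2 = D ^ 2 / κ ^ 2 / n := by
    rw [hM, div_pow, mul_pow, Real.sq_sqrt hnR.le]; field_simp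
  rw [mul_assoc 4, mul_assoc 2, h1, h2]
  field_simp

end BlockModel

end SBM

/-! ### Choice of constants and union of the exceptional events. -/

open SBM in
theorem mainTheorem1 (p q : unitInterval) (hq : 0 < q) (hqp : q < p) (hp : p < 1)
    (ε₀ : ℝ) (hε₀ : 0 < ε₀) :
    ∃ K : ℝ, 0 < K ∧ ∃ c : ℝ, 0 < c ∧ ∃ N : ℕ, ∀ n : ℕ, N ≤ n → Even n →
      (SBM.law n p q).real
          {G : SimpleGraph (Fin n) | ¬ ∀ v : EuclideanSpace ℝ (Fin n),
            SBM.IsSecondEigenvector G v →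
              ‖SBM.e2 v - SBM.mainTerm (p : ℝ) (q : ℝ) G‖ ≤ K * (n : ℝ) ^ (-1 + ε₀)}
        ≤ Real.exp (-(c * (n : ℝ) ^ (min 1 (2 * ε₀)))) := by
  obtain ⟨C, hC, hprob⟩ := exists_law_norm_noiseOp_gt_le p q
  have hq0 : (0 : ℝ) < q := hq
  have hpq : (0 : ℝ) < p - q := sub_pos.2 hqp
  have hp0 : (0 : ℝ) < p := by linarith
  set κ : ℝ := min (((p : ℝ) - q) / 4) ((q : ℝ) / 2) with hκ
  have hκ0 : 0 < κ := lt_min (by positivity) (by positivity)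
  set m : ℝ := min 1 (2 * ε₀) with hm
  have hm0 : 0 < m := lt_min one_pos (by positivity)
  -- The constant of `norm_e2_sub_mainTerm_le` with 1 in place of `τ`; as `τ ≥ 1`, multiplying it by
  -- `τ` dominates every term.
  set K : ℝ := 4 * (C + 1) ^ 2 / (κ * (((p : ℝ) - q) / 2)) +
    ((p : ℝ) + q) / ((p : ℝ) - q) * ((1 + 2 * (C + 1) ^ 2 / κ) / κ) +
    2 * (C + 1) ^ 2 / κ ^ 2 with hK
  have hcast := tendsto_natCast_atTop_atTop (R := ℝ)
  have hev : ∀ᶠ n : ℕ in Filter.atTop,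
      1 < n ∧ 4 * (C + 1) / κ ≤ √(n : ℝ) ∧ 2 * Real.log 4 ≤ (n : ℝ) ^ m :=
    (Filter.eventually_gt_atTop 1).and
      (((Real.tendsto_sqrt_atTop.comp hcast).eventually_ge_atTop _).and
        (((tendsto_rpow_atTop hm0).comp hcast).eventually_ge_atTop _))
  obtain ⟨N, hN⟩ := Filter.eventually_atTop.1 hev
  -- Half of the exponent `n ^ m` is spent on the prefactor 4 of the union bound, hence `c = 1 / 2`
  -- and the condition `2 log 4 ≤ n ^ m`.
  refine ⟨K, by positivity, 1 / 2, by norm_num, N, fun n hn hne => ?_⟩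
  obtain ⟨hn1, hlarge, hlog⟩ := hN n hn
  rw [div_le_iff₀ hκ0, mul_comm (√_)] at hlarge
  have hn0 : 0 < n := by omega
  have hnR : (1 : ℝ) ≤ n := by exact_mod_cast hn0
  set τ : ℝ := (n : ℝ) ^ ε₀ with hτ
  have hτ1 : 1 ≤ τ := Real.one_le_rpow hnR hε₀.le
  have hsub : {G : SimpleGraph (Fin n) | ¬ ∀ v : EuclideanSpace ℝ (Fin n),
      SBM.IsSecondEigenvector G v →
        ‖SBM.e2 v - SBM.mainTerm (p : ℝ) (q : ℝ) G‖ ≤ K * (n : ℝ) ^ (-1 + ε₀)} ⊆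
      {G | C * √n < ‖noiseOp p q G‖} ∪
        {G | τ ≤ |inner ℝ (unitOnes n) (noiseOp p q G (unitGroupVec n))|} := fun G hG => by
    by_contra hcon
    simp only [Set.mem_union, Set.mem_ofPred_eq, not_or, not_lt, not_le] at hcon hG
    refine hG fun v hv => ?_
    refine (norm_e2_sub_mainTerm_le hn1 hne hqp hC.le hκ0 (min_le_left _ _) (min_le_right _ _)
      hlarge hcon.1 hcon.2.le hv).trans ?_
    have hKn : K * (n : ℝ) ^ (-1 + ε₀) = K * τ / n := by
      rw [Real.rpow_add (by positivity), Real.rpow_neg_one]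
      ring
    rw [hKn]
    refine div_le_div_of_nonneg_right ?_ (Nat.cast_nonneg n)
    have h1 : ∀ z : ℝ, 0 ≤ z → z ≤ z * τ := fun z hz => le_mul_of_one_le_right hz hτ1
    rw [hK, add_mul, add_mul]
    refine add_le_add (add_le_add ?_ ?_) ?_
    · exact h1 _ (by positivity)
    swap
    · exact h1 _ (by positivity)
    rw [mul_assoc, div_mul_eq_mul_div _ κ]
    gcongr
    linarith [h1 (2 * (C + 1) ^ 2 / κ) (by positivity)]
  have hmono : ∀ r : ℝ, m ≤ r → Real.exp (-(n : ℝ) ^ r) ≤ Real.exp (-(n : ℝ) ^ m) := fun r hr =>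
    Real.exp_le_exp.2 (neg_le_neg (Real.rpow_le_rpow_of_exponent_le hnR hr))
  have hτ2 : τ ^ 2 = (n : ℝ) ^ (2 * ε₀) := by
    rw [hτ, ← Real.rpow_natCast, ← Real.rpow_mul (by positivity)]
    norm_num [mul_comm]
  calc _ ≤ 2 * Real.exp (-n) + 2 * Real.exp (-τ ^ 2) :=
        (measureReal_mono hsub (measure_ne_top _ _)).trans ((measureReal_union_le _ _).trans
          (add_le_add (hprob n hn0) (law_abs_inner_noiseOp_ge_le p q (norm_unitOnes hn0).le
            (norm_unitGroupVec hn0).le (zero_le_one.trans hτ1))))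
    _ ≤ 2 * Real.exp (-(n : ℝ) ^ m) + 2 * Real.exp (-(n : ℝ) ^ m) := by
        have h1 := hmono 1 (min_le_left _ _)
        rw [Real.rpow_one] at h1
        rw [hτ2]
        gcongr
        exact min_le_right _ _
    _ = Real.exp (Real.log 4 - (n : ℝ) ^ m) := by
        rw [sub_eq_add_neg, Real.exp_add, Real.exp_log (by norm_num)]; ring
    _ ≤ _ := Real.exp_le_exp.2 (by linarith)
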